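/- Let $G$ be a locally compact Hausdorff topological groupoid with unit space $G^{(0)}$ and source and range maps $s,r$. (No Haar system and no second countability are needed.) Let $A$ be a $C_0(G^{(0)})$-algebra, i.e. a $C^*$-algebra with a nondegenerate $*$-homomorphism $\Phi$ from $C_0(G^{(0)})$ to the centre of the multiplier algebra $M(A)$. For $u\in G^{(0)}$ let $I_u=\overline{\operatorname{span}}\{\Phi(f)a : f(u)=0,\ a\in A\}$ and $A(u)=A/I_u$, write $a(u)$ for the image of $a$ in $A(u)$, and give $\mathcal A=\bigsqcup_u A(u)$, with projection $p:\mathcal A\to G^{(0)}$, the topology of the associated upper-semicontinuous $C^*$-bundle, generated by the sets $\{b : p(b)\in U,\ \|a(p(b))-b\|<\varepsilon\}$ ($a\in A$, $U\subseteq G^{(0)}$ open, $\varepsilon>0$). Let $(A,G,\alpha)$ be a groupoid dynamical system: a family of $*$-isomorphisms $\alpha_\gamma:A(s(\gamma))\to A(r(\gamma))$ with $\alpha_{\gamma\eta}=\alpha_\gamma\circ\alpha_\eta$ whenever $s(\gamma)=r(\eta)$, such that $(\gamma,b)\mapsto\alpha_\gamma(b)$ is continuous from $\{(\gamma,b)\in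 G\times\mathcal A : s(\gamma)=p(b)\}$ to $\mathcal A$. Let $\widehat A$ be the spectrum of $A$: the unitary equivalence classes of irreducible representations of $A$, with the hull-kernel topology. Then there is exactly one continuous action of $G$ on $\widehat A$ with the following two properties. Its anchor map $r_{\widehat A}:\widehat A\to G^{(0)}$ is given by: $r_{\widehat A}(\pi)=u$ if and only if $I_u\subseteq\ker\pi$, i.e. $\pi$ factors through a representation $\pi'$ of $A(u)$. And for $\gamma\in G$ and $\pi\in\widehat A$ with $r_{\widehat A}(\pi)=s(\gamma)$, $$(\gamma\cdot\pi)(a)=\pi'\bigl(\alpha_\gamma^{-1}(a(r(\gamma)))\bigr)\qquad(a\in A),$$ that is, $\gamma\cdot\pi=\pi\circ\alpha_\gamma^{-1}$ on the fibres. Here a continuous action means: $r_{\widehat A}$ is continuous; $r_{\widehat A}(\gamma\cdot\pi)=r(\gamma)$; units act trivially; $(\gamma\eta)\cdot\pi=\gamma\cdot(\eta\cdot\pi)$ whenever $s(\gamma)=r(\eta)$ and $s(\eta)=r_{\widehat A}(\pi)$; and $(\gamma,\pi)\mapsto\gamma\cdot\pi$ is continuous on $\{(\gamma,\pi)\in G\times\widehat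 A : s(\gamma)=r_{\widehat A}(\pi)\}$. -/

import Mathlib

open CategoryTheory
open scoped MultiplierAlgebra ZeroAtInfty

noncomputable section

/-! ## Topological groupoids and their continuous actions

A groupoid with unit space `X` is a `Groupoid X`. Its space of arrows is `Quiver.Total X`: the
source of `γ` is `γ.left` and its range is `γ.right`. The product `γη` (first `η`, then `γ`) is
`η ≫ γ`. -/

/-- A topological groupoid: the unit space `X` and the space of arrows carry topologies for which
all structure maps are continuous. Since `source ∘ unit = id`, the unit map is then automatically
a topological embedding of `X` in the space of arrows. -/
class TopologicalGroupoid (X : Type*) [Groupoid X] [TopologicalSpace X]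
    [TopologicalSpace (Quiver.Total X)] : Prop where
  continuous_source : Continuous fun γ : Quiver.Total X => γ.left
  continuous_range : Continuous fun γ : Quiver.Total X => γ.right
  continuous_unit : Continuous fun u : X => (⟨u, u, 𝟙 u⟩ : Quiver.Total X)
  continuous_inv : Continuous fun γ : Quiver.Total X =>
    (⟨γ.right, γ.left, Groupoid.inv γ.hom⟩ : Quiver.Total X)
  continuous_mul : Continuous fun p : {p : Quiver.Total X × Quiver.Total X // p.1.right = p.2.left} =>
    (⟨p.1.1.left, p.1.2.right, p.1.1.hom ≫ eqToHom p.2 ≫ p.1.2.hom⟩ : Quiver.Total X)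

/-- A continuous (left) action of a topological groupoid on a space `Y` fibred over the unit
space by the continuous map `anchor`. An arrow `γ` maps the fibre over its source to the fibre
over its range, and `(γ, y) ↦ γ · y` is continuous on `{(γ, y) | s(γ) = anchor y}`. -/
structure ContinuousGroupoidAction (X : Type*) [Groupoid X] [TopologicalSpace X]
    [TopologicalSpace (Quiver.Total X)] (Y : Type*) [TopologicalSpace Y] where
  anchor : Y → X
  act : ∀ {u v : X}, (u ⟶ v) → {y : Y // anchor y = u} → {y : Y // anchor y = v}
  act_unit : ∀ (u : X) (y : {y : Y // anchor y = u}), act (𝟙 u) y = y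
  act_mul : ∀ {u v w : X} (η : u ⟶ v) (γ : v ⟶ w) (y : {y : Y // anchor y = u}),
    act (η ≫ γ) y = act γ (act η y)
  continuous_anchor : Continuous anchor
  continuous_act : Continuous fun p : {p : Quiver.Total X × Y // anchor p.2 = p.1.left} =>
    (act p.1.1.hom ⟨p.1.2, p.2⟩ : Y)

/-! ## Irreducible representations and the spectrum -/

section Spectrum

universe w

variable {A B : Type w} [NonUnitalRing A] [StarRing A] [Module ℂ A]
  [NonUnitalRing B] [StarRing B] [Module ℂ B]

/-- An irreducible representation of a star-algebra: a nonzero star-homomorphism into the bounded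
operators of a Hilbert space without nontrivial closed invariant subspaces. (An irreducible
representation of a C⋆-algebra `A` is cyclic, so it is equivalent to one on a Hilbert space in the
universe of `A`.) -/
structure IrrRep (A : Type w) [NonUnitalRing A] [StarRing A] [Module ℂ A] where
  H : Type w
  [instNormed : NormedAddCommGroup H]
  [instInner : InnerProductSpace ℂ H]
  [instComplete : CompleteSpace H]
  toHom : A →⋆ₙₐ[ℂ] (H →L[ℂ] H)
  nonzero : ∃ a, toHom a ≠ 0
  irreducible : ∀ K : Submodule ℂ H, IsClosed (K : Set H) →
    (∀ a, ∀ x ∈ K, toHom a x ∈ K) → K = ⊥ ∨ K = ⊤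

attribute [instance] IrrRep.instNormed IrrRep.instInner IrrRep.instComplete

namespace IrrRep

/-- Unitary equivalence of representations. -/
def Equiv (π ρ : IrrRep A) : Prop :=
  ∃ U : π.H ≃ₗᵢ[ℂ] ρ.H, ∀ (a : A) (x : π.H), U (π.toHom a x) = ρ.toHom a (U x)

instance setoid (A : Type w) [NonUnitalRing A] [StarRing A] [Module ℂ A] : Setoid (IrrRep A) where
  r := Equiv
  iseqv :=
    { refl := fun π => ⟨LinearIsometryEquiv.refl ℂ π.H, fun _ _ => rfl⟩
      symm := by
        rintro π ρ ⟨U, hU⟩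
        refine ⟨U.symm, fun a x => ?_⟩
        rw [LinearIsometryEquiv.symm_apply_eq, hU, LinearIsometryEquiv.apply_symm_apply]
      trans := by
        rintro π ρ σ ⟨U, hU⟩ ⟨V, hV⟩
        refine ⟨U.trans V, fun a x => ?_⟩
        simp [hU, hV] }

/-- The kernel of an irreducible representation. -/
def ker (π : IrrRep A) : Set A := {a | π.toHom a = 0}

/-- The composition `π ∘ φ` with a surjective star-homomorphism `φ`. -/
def comp (π : IrrRep B) (φ : A →⋆ₙₐ[ℂ] B) (hφ : Function.Surjective φ) : IrrRep A where
  H := π.H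
  toHom := π.toHom.comp φ
  nonzero := by
    obtain ⟨b, hb⟩ := π.nonzero
    obtain ⟨a, rfl⟩ := hφ b
    exact ⟨a, hb⟩
  irreducible K hK h := by
    refine π.irreducible K hK fun b x hx => ?_
    obtain ⟨a, rfl⟩ := hφ b
    exact h a x hx

end IrrRep

/-- The spectrum of `A`: unitary equivalence classes of irreducible representations. -/
def IrrSpectrum (A : Type w) [NonUnitalRing A] [StarRing A] [Module ℂ A] : Type (w + 1) :=
  Quotient (IrrRep.setoid A)

namespace IrrSpectrum

/-- The class of an irreducible representation in the spectrum. -/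
def mk (π : IrrRep A) : IrrSpectrum A := Quotient.mk _ π

/-- The kernel of (any representative of) a point of the spectrum. -/
def ker (σ : IrrSpectrum A) : Set A :=
  Quotient.lift IrrRep.ker (by
    rintro π ρ ⟨U, hU⟩
    ext a
    constructor
    · intro h
      replace h : π.toHom a = 0 := h
      change ρ.toHom a = 0
      ext y
      have := hU a (U.symm y)
      rw [h, LinearIsometryEquiv.apply_symm_apply] at this
      simpa using this.symm
    · intro h
      replace h : ρ.toHom a = 0 := h
      change π.toHom a = 0
      ext x
      have := hU a x
      rw [h] at this
      simpa using this) σ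

/-- The hull-kernel (Jacobson) topology, whose open sets are the sets
`{σ | ¬ J ⊆ ker σ}` for the closed two-sided ideals `J`. -/
instance [TopologicalSpace A] : TopologicalSpace (IrrSpectrum A) :=
  TopologicalSpace.generateFrom
    {O | ∃ J : TwoSidedIdeal A, IsClosed (J : Set A) ∧ O = {σ | ¬ (J : Set A) ⊆ σ.ker}}

end IrrSpectrum

end Spectrum

/-! ## `C₀(X)`-algebras, their fibres and their upper-semicontinuous bundles -/

/-- A `C₀(X)`-algebra structure on a C⋆-algebra `A`: a nondegenerate star-homomorphism from
`C₀(X)` to the centre of the multiplier algebra of `A`. -/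
structure C0Algebra (X : Type*) [TopologicalSpace X] (A : Type*) [NonUnitalCStarAlgebra A] where
  Φ : C₀(X, ℂ) →⋆ₙₐ[ℂ] 𝓜(ℂ, A)
  central : ∀ (f : C₀(X, ℂ)) (m : 𝓜(ℂ, A)), Φ f * m = m * Φ f
  nondegenerate :
    (Submodule.span ℂ {b : A | ∃ (f : C₀(X, ℂ)) (a : A), b = (Φ f).fst a}).topologicalClosure = ⊤

namespace C0Algebra

variable {X : Type*} [TopologicalSpace X] {A : Type*} [NonUnitalCStarAlgebra A]

/-- The product `f · a = Φ(f) a`. -/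
def smul (S : C0Algebra X A) (f : C₀(X, ℂ)) (a : A) : A := (S.Φ f).fst a

/-- The ideal `I_u`, the closed span of the elements `f · a` with `f u = 0`. -/
def fiberIdeal (S : C0Algebra X A) (u : X) : Submodule ℂ A :=
  (Submodule.span ℂ {b : A | ∃ (f : C₀(X, ℂ)) (a : A), f u = 0 ∧ b = S.smul f a}).topologicalClosure

variable (S : C0Algebra X A) (u : X)

instance isClosed_fiberIdeal : IsClosed (S.fiberIdeal u : Set A) :=
  Submodule.isClosed_topologicalClosure _

lemma mul_smul' (f : C₀(X, ℂ)) (a b : A) : a * S.smul f b = S.smul f (a * b) := by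
  have h := congrArg (fun m : 𝓜(ℂ, A) => m.fst b) (S.central f (a : 𝓜(ℂ, A)))
  simpa [smul] using h.symm

lemma snd_eq (f : C₀(X, ℂ)) (a : A) : (S.Φ f).snd a = S.smul f a := by
  have cancel : ∀ x y : A, (∀ c, c * x = c * y) → x = y := fun x y h => by
    rw [← sub_eq_zero, ← CStarRing.star_mul_self_eq_zero_iff, mul_sub, h, sub_self]
  have cancel' : ∀ x y : A, (∀ c, x * c = y * c) → x = y := fun x y h => by
    rw [← sub_eq_zero, ← CStarRing.mul_star_self_eq_zero_iff, sub_mul, h, sub_self]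
  have hR : ∀ c b : A, (S.Φ f).snd (c * b) = c * (S.Φ f).snd b := fun c b => by
    refine cancel' _ _ fun z => ?_
    rw [mul_assoc, (S.Φ f).central, (S.Φ f).central, mul_assoc]
  have hR' : ∀ c b : A, (S.Φ f).snd (c * b) = (S.Φ f).snd c * b := fun c b => by
    have h := congrArg (fun m : 𝓜(ℂ, A) => m.snd c) (S.central f (b : 𝓜(ℂ, A)))
    simpa using h.symm
  refine cancel _ _ fun c => ?_
  rw [← hR, hR', (S.Φ f).central, smul]

lemma smul_mul (f : C₀(X, ℂ)) (a b : A) : S.smul f a * b = S.smul f (a * b) := by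
  rw [← snd_eq, (S.Φ f).central, ← smul, mul_smul']

lemma star_smul (f : C₀(X, ℂ)) (a : A) : star (S.smul f a) = S.smul (star f) (star a) := by
  rw [← snd_eq S (star f), map_star S.Φ f, DoubleCentralizer.star_snd, star_star, smul]

variable {u}

/-- A continuous (conjugate-)linear map that preserves the generators of `I_u` preserves `I_u`. -/
lemma map_mem (T : A → A) (hT : Continuous T) (h0 : T 0 = 0) (hadd : ∀ x y, T (x + y) = T x + T y)
    (hsm : ∀ (c : ℂ) (x : A), ∃ d : ℂ, T (c • x) = d • T x)
    (hgen : ∀ (f : C₀(X, ℂ)) (a : A), f u = 0 → ∃ (g : C₀(X, ℂ)) (b : A), g u = 0 ∧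
      T (S.smul f a) = S.smul g b)
    {a : A} (ha : a ∈ S.fiberIdeal u) : T a ∈ S.fiberIdeal u := by
  have hsub : ∀ x ∈ Submodule.span ℂ
      {b : A | ∃ (f : C₀(X, ℂ)) (a : A), f u = 0 ∧ b = S.smul f a},
      T x ∈ Submodule.span ℂ {b : A | ∃ (f : C₀(X, ℂ)) (a : A), f u = 0 ∧ b = S.smul f a} := by
    intro x hx
    induction hx using Submodule.span_induction with
    | mem x hx =>
      obtain ⟨f, a, hf, rfl⟩ := hx
      obtain ⟨g, b, hg, h⟩ := hgen f a hf
      exact Submodule.subset_span ⟨g, b, hg, h⟩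
    | zero => rw [h0]; exact Submodule.zero_mem _
    | add x y _ _ hx hy => rw [hadd]; exact Submodule.add_mem _ hx hy
    | smul c x _ hx =>
      obtain ⟨d, hd⟩ := hsm c x
      rw [hd]
      exact Submodule.smul_mem _ _ hx
  exact map_mem_closure hT ha hsub

lemma mul_mem_left (a : A) {b : A} (hb : b ∈ S.fiberIdeal u) : a * b ∈ S.fiberIdeal u :=
  S.map_mem (fun x => a * x) (by fun_prop) (mul_zero a) (mul_add a)
    (fun c x => ⟨c, mul_smul_comm c a x⟩) (fun f b hf => ⟨f, a * b, hf, S.mul_smul' f a b⟩) hb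

lemma mul_mem_right {a : A} (b : A) (ha : a ∈ S.fiberIdeal u) : a * b ∈ S.fiberIdeal u :=
  S.map_mem (fun x => x * b) (by fun_prop) (zero_mul b) (fun x y => add_mul x y b)
    (fun c x => ⟨c, smul_mul_assoc c x b⟩) (fun f a hf => ⟨f, a * b, hf, S.smul_mul f a b⟩) ha

lemma star_mem {a : A} (ha : a ∈ S.fiberIdeal u) : star a ∈ S.fiberIdeal u :=
  S.map_mem (fun x => star x) continuous_star (star_zero A) star_add
    (fun c x => ⟨star c, StarModule.star_smul c x⟩)
    (fun f a hf => ⟨star f, star a, by simp [hf], S.star_smul f a⟩) ha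

variable (u)

/-- The fibre `A(u) = A / I_u`, with the quotient norm and the quotient star-algebra structure. -/
def Fiber : Type _ := A ⧸ S.fiberIdeal u

namespace Fiber

instance : NormedAddCommGroup (S.Fiber u) := inferInstanceAs (NormedAddCommGroup (A ⧸ S.fiberIdeal u))

instance : Module ℂ (S.Fiber u) := inferInstanceAs (Module ℂ (A ⧸ S.fiberIdeal u))

/-- The quotient map `a ↦ a(u)`. -/
def mk (a : A) : S.Fiber u := Submodule.Quotient.mk a

variable {u}

lemma mk_surjective : Function.Surjective (mk S u) := Submodule.Quotient.mk_surjective _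

lemma mk_eq_mk {a b : A} : mk S u a = mk S u b ↔ a - b ∈ S.fiberIdeal u :=
  Submodule.Quotient.eq _

instance : Mul (S.Fiber u) where
  mul := Quotient.map₂ (· * ·) (by
    intro a a' ha b b' hb
    change Submodule.quotientRel _ _ _ at ha
    change Submodule.quotientRel _ _ _ at hb
    change Submodule.quotientRel _ _ _
    rw [Submodule.quotientRel_def] at ha hb ⊢
    have : a * b - a' * b' = (a - a') * b + a' * (b - b') := by noncomm_ring
    rw [this]
    exact Submodule.add_mem _ (S.mul_mem_right _ ha) (S.mul_mem_left _ hb))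

instance : Star (S.Fiber u) where
  star := Quotient.map star (by
    intro a a' ha
    change Submodule.quotientRel _ _ _ at ha
    change Submodule.quotientRel _ _ _
    rw [Submodule.quotientRel_def] at ha ⊢
    rw [← star_sub]
    exact S.star_mem ha)

lemma mk_zero : mk S u 0 = 0 := rfl
lemma mk_add (a b : A) : mk S u (a + b) = mk S u a + mk S u b := rfl
lemma mk_smul (c : ℂ) (a : A) : mk S u (c • a) = c • mk S u a := rfl
lemma mk_mul (a b : A) : mk S u (a * b) = mk S u a * mk S u b := rfl
lemma mk_star (a : A) : mk S u (star a) = star (mk S u a) := rfl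

instance : NonUnitalRing (S.Fiber u) :=
  { (inferInstance : AddCommGroup (S.Fiber u)), (inferInstance : Mul (S.Fiber u)) with
    left_distrib := by
      intro x y z
      obtain ⟨a, rfl⟩ := mk_surjective S x
      obtain ⟨b, rfl⟩ := mk_surjective S y
      obtain ⟨c, rfl⟩ := mk_surjective S z
      rw [← mk_add, ← mk_mul, mul_add]; rfl
    right_distrib := by
      intro x y z
      obtain ⟨a, rfl⟩ := mk_surjective S x
      obtain ⟨b, rfl⟩ := mk_surjective S y
      obtain ⟨c, rfl⟩ := mk_surjective S z
      rw [← mk_add, ← mk_mul, add_mul]; rfl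
    zero_mul := by
      intro x
      obtain ⟨a, rfl⟩ := mk_surjective S x
      rw [← mk_zero, ← mk_mul, zero_mul]
    mul_zero := by
      intro x
      obtain ⟨a, rfl⟩ := mk_surjective S x
      rw [← mk_zero, ← mk_mul, mul_zero]
    mul_assoc := by
      intro x y z
      obtain ⟨a, rfl⟩ := mk_surjective S x
      obtain ⟨b, rfl⟩ := mk_surjective S y
      obtain ⟨c, rfl⟩ := mk_surjective S z
      simp only [← mk_mul, mul_assoc] }

instance : StarRing (S.Fiber u) where
  star_involutive := by
    intro x
    obtain ⟨a, rfl⟩ := mk_surjective S x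
    simp only [← mk_star, star_star]
  star_mul := by
    intro x y
    obtain ⟨a, rfl⟩ := mk_surjective S x
    obtain ⟨b, rfl⟩ := mk_surjective S y
    simp only [← mk_star, ← mk_mul, star_mul]
  star_add := by
    intro x y
    obtain ⟨a, rfl⟩ := mk_surjective S x
    obtain ⟨b, rfl⟩ := mk_surjective S y
    simp only [← mk_star, ← mk_add, star_add]

variable (u)

/-- The quotient map `A → A(u)` as a star-homomorphism. -/
def mkHom : A →⋆ₙₐ[ℂ] S.Fiber u where
  toFun := mk S u
  map_smul' := mk_smul S
  map_zero' := mk_zero S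
  map_add' := mk_add S
  map_mul' := mk_mul S
  map_star' := mk_star S

end Fiber

/-- The total space of the bundle with fibres `A(u)`; the projection to `X` is `base`. -/
structure Bundle where
  base : X
  val : S.Fiber base

/-- The topology of the upper-semicontinuous C⋆-bundle associated to `A`, generated by the sets
`{b | p(b) ∈ U, ‖a(p(b)) - b‖ < ε}` for `a ∈ A`, `U ⊆ X` open and `ε > 0`. -/
instance : TopologicalSpace S.Bundle :=
  TopologicalSpace.generateFrom
    {W | ∃ (a : A) (U : Set X) (ε : ℝ), IsOpen U ∧ 0 < ε ∧
      W = {b | b.base ∈ U ∧ ‖Fiber.mk S b.base a - b.val‖ < ε}}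

variable {S u}

/-- The irreducible representation `π'` of `A(u)` through which `π` factors when
`I_u ⊆ ker π`. -/
def factor (π : IrrRep A) (hπ : (S.fiberIdeal u : Set A) ⊆ π.ker) : IrrRep (S.Fiber u) where
  H := π.H
  toHom :=
    { toFun := (S.fiberIdeal u).liftQ (π.toHom : A →ₗ[ℂ] (π.H →L[ℂ] π.H)) hπ
      map_smul' := fun c x => map_smul _ c x
      map_zero' := map_zero _
      map_add' := map_add _
      map_mul' := by
        intro x y
        obtain ⟨a, rfl⟩ := Fiber.mk_surjective S x
        obtain ⟨b, rfl⟩ := Fiber.mk_surjective S y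
        exact map_mul π.toHom a b
      map_star' := by
        intro x
        obtain ⟨a, rfl⟩ := Fiber.mk_surjective S x
        exact map_star π.toHom a }
  nonzero := by
    obtain ⟨a, ha⟩ := π.nonzero
    exact ⟨Fiber.mk S u a, ha⟩
  irreducible K hK h := π.irreducible K hK fun a x hx => h (Fiber.mk S u a) x hx

end C0Algebra

/-! ## Groupoid dynamical systems -/

/-- An action `α` of the groupoid on the `C₀(X)`-algebra `A`: star-isomorphisms
`α_γ : A(s(γ)) → A(r(γ))` with `α_{γη} = α_γ ∘ α_η`, such that `(γ, b) ↦ α_γ(b)` is continuous from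
`{(γ, b) | s(γ) = p(b)}` to the upper-semicontinuous bundle of `A`. -/
structure GroupoidDynamicalSystem {X : Type*} [Groupoid X] [TopologicalSpace X]
    [TopologicalSpace (Quiver.Total X)] {A : Type*} [NonUnitalCStarAlgebra A]
    (S : C0Algebra X A) where
  α : ∀ {u v : X}, (u ⟶ v) → (S.Fiber u ≃⋆ₐ[ℂ] S.Fiber v)
  α_mul : ∀ {u v w : X} (η : u ⟶ v) (γ : v ⟶ w) (b : S.Fiber u), α (η ≫ γ) b = α γ (α η b)
  continuous_α : Continuous fun p : {p : Quiver.Total X × S.Bundle // p.2.base = p.1.left} =>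
    (⟨p.1.1.right, α p.1.1.hom (p.2 ▸ p.1.2.val)⟩ : S.Bundle)

namespace GroupoidDynamicalSystem

variable {X : Type*} [Groupoid X] [TopologicalSpace X] [TopologicalSpace (Quiver.Total X)]
  {A : Type*} [NonUnitalCStarAlgebra A] {S : C0Algebra X A}

/-- For `γ : u ⟶ v` and an irreducible representation `π` of `A` factoring through a
representation `π'` of `A(u)`, the irreducible representation `a ↦ π'(α_γ⁻¹(a(v)))` of `A`. -/
def translate (D : GroupoidDynamicalSystem S) {u v : X} (γ : u ⟶ v) (π : IrrRep A)
    (hπ : (S.fiberIdeal u : Set A) ⊆ π.ker) : IrrRep A :=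
  ((C0Algebra.factor π hπ).comp ((D.α γ).symm : S.Fiber v →⋆ₙₐ[ℂ] S.Fiber u)
    (D.α γ).symm.surjective).comp (C0Algebra.Fiber.mkHom S v) (C0Algebra.Fiber.mk_surjective S)

end GroupoidDynamicalSystem

end

/-! Let `π` be irreducible. The functions `f` with `π(f · a) = 0` for all `a` form a proper closed
set `N` in `C₀(X)`: nondegeneracy makes it proper, and irreducibility makes it prime. A compactness
argument then finds a point `u` such that `N` contains every function vanishing at `u`, so `I_u ⊆
ker π` (`exists_fiberIdeal_subset_ker`). Urysohn functions show that `u` is unique and depends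
continuously on `π`. The algebraic laws of the action follow from the multiplicativity of `α`.

Continuity of the action balances two semicontinuities. If `γ₀ · π₀` does not kill `a`, lift
`α_{γ₀}⁻¹(a(r(γ₀)))` to some `b` in `A` and put `δ = ‖π₀(b)‖ / 2`. By continuity in the bundle,
`b(s(γ))` is within `δ` of `α_γ⁻¹(a(r(γ)))` for `γ` near `γ₀`. By lower semicontinuity of `π ↦
‖π(b)‖`, one has `‖π(b)‖ > δ` for `π` near `π₀`. Hence `γ · π` does not kill `a` either
(`exists_isOpen_translate_notMem_ker`). Uniqueness holds because the two properties prescribe both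
the anchor and the action. -/

noncomputable section

open Filter Topology

universe w

/-! ### Closed prime sets of functions in `C₀(X)`. -/

namespace ZeroAtInftyContinuousMap

variable {X : Type*} [TopologicalSpace X]

/-- The continuous function `z ↦ z (|z| - ε)⁺ / max |z| ε`, which vanishes on the disc of radius
`ε` and is at distance at most `ε` from the identity. -/
def discTruncation (ε : ℝ) (z : ℂ) : ℂ := z * ((max (‖z‖ - ε) 0 / max ‖z‖ ε : ℝ) : ℂ)

lemma continuous_discTruncation {ε : ℝ} (hε : 0 < ε) : Continuous (discTruncation ε) := by
  refine continuous_id.mul (Complex.continuous_ofReal.comp (Continuous.div ?_ ?_ fun z => ?_))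
  · fun_prop
  · fun_prop
  · exact (lt_max_of_lt_right hε).ne'

lemma discTruncation_eq_zero {ε : ℝ} {z : ℂ} (hz : ‖z‖ ≤ ε) : discTruncation ε z = 0 := by
  simp [discTruncation, max_eq_right (sub_nonpos.2 hz)]

lemma norm_sub_discTruncation_le {ε : ℝ} (hε : 0 < ε) (z : ℂ) : ‖z - discTruncation ε z‖ ≤ ε := by
  rcases le_total ‖z‖ ε with h | h
  · simpa [discTruncation_eq_zero h] using h
  · have hz : 0 < ‖z‖ := hε.trans_le h
    have : z - discTruncation ε z = z * ((ε / ‖z‖ : ℝ) : ℂ) := by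
      rw [discTruncation, max_eq_left (sub_nonneg.2 h), max_eq_left h, sub_div, div_self hz.ne']
      push_cast
      ring
    rw [this, norm_mul, Complex.norm_real, Real.norm_of_nonneg (by positivity),
      mul_div_cancel₀ _ hz.ne']

/-- The truncation of a function vanishing at infinity to the set where `ε < |f|`. -/
def truncate (f : C₀(X, ℂ)) {ε : ℝ} (hε : 0 < ε) : C₀(X, ℂ) where
  toFun x := discTruncation ε (f x)
  continuous_toFun := (continuous_discTruncation hε).comp (map_continuous f)
  zero_at_infty' := by
    have h := ((continuous_discTruncation hε).tendsto 0).comp (zero_at_infty f)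
    rwa [discTruncation_eq_zero (by simpa using hε.le)] at h

lemma truncate_apply_eq_zero (f : C₀(X, ℂ)) {ε : ℝ} (hε : 0 < ε) {x : X} (hx : ‖f x‖ ≤ ε) :
    f.truncate hε x = 0 :=
  discTruncation_eq_zero hx

lemma dist_truncate_le (f : C₀(X, ℂ)) {ε : ℝ} (hε : 0 < ε) : dist f (f.truncate hε) ≤ ε := by
  rw [← dist_toBCF_eq_dist, BoundedContinuousFunction.dist_le hε.le]
  intro x
  rw [dist_eq_norm]
  exact norm_sub_discTruncation_le hε (f x)

lemma isCompact_le_norm (f : C₀(X, ℂ)) {ε : ℝ} (hε : 0 < ε) : IsCompact {x | ε ≤ ‖f x‖} := by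
  have h : ∀ᶠ x in cocompact X, f x ∈ Metric.ball (0 : ℂ) ε :=
    zero_at_infty f (Metric.ball_mem_nhds 0 hε)
  obtain ⟨K, hK, hKs⟩ := mem_cocompact.1 h
  refine hK.of_isClosed_subset (isClosed_le continuous_const (map_continuous f).norm) fun x hx => ?_
  by_contra hxK
  have : ‖f x‖ < ε := mem_ball_zero_iff.1 (hKs hxK)
  exact absurd (show ε ≤ ‖f x‖ from hx) this.not_ge

/-- If a closed set of functions contains all truncations of `f`, it contains `f`. -/
lemma mem_of_truncate_mem {N : Set C₀(X, ℂ)} (hN : IsClosed N) (f : C₀(X, ℂ))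
    (h : ∀ (ε : ℝ) (hε : 0 < ε), f.truncate hε ∈ N) : f ∈ N := by
  rw [← hN.closure_eq, Metric.mem_closure_iff]
  intro ε hε
  exact ⟨_, h (ε / 2) (half_pos hε), (f.dist_truncate_le _).trans_lt (half_lt_self hε)⟩

/-- A proper closed set of functions that is prime for multiplication contains, for some point,
all the functions that vanish there. -/
lemma exists_forall_apply_eq_zero_mem {N : Set C₀(X, ℂ)} (hN : IsClosed N) (hN' : N ≠ Set.univ)
    (h0 : 0 ∈ N) (hprime : ∀ f g : C₀(X, ℂ), f * g ∈ N → f ∈ N ∨ g ∈ N) :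
    ∃ u, ∀ f : C₀(X, ℂ), f u = 0 → f ∈ N := by
  by_contra! hcon
  -- A function outside `N` vanishing at `u` has a truncation outside `N`, and this one vanishes on
  -- a whole neighbourhood of `u`.
  have hloc : ∀ u : X, ∃ g : C₀(X, ℂ), g ∉ N ∧ ∀ᶠ x in 𝓝 u, g x = 0 := by
    intro u
    obtain ⟨f, hfu, hf⟩ := hcon u
    obtain ⟨ε, hε, hfε⟩ : ∃ (ε : ℝ) (hε : 0 < ε), f.truncate hε ∉ N := by
      by_contra! h
      exact hf (mem_of_truncate_mem hN f h)
    refine ⟨_, hfε, ?_⟩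
    have : ∀ᶠ x in 𝓝 u, ‖f x‖ < ε :=
      (map_continuous f).norm.continuousAt.eventually_lt continuousAt_const (by simpa [hfu] using hε)
    filter_upwards [this] with x hx using f.truncate_apply_eq_zero hε hx.le
  -- Compact induction: primeness keeps products of functions outside `N` outside `N`, and
  -- properness of `N` supplies the case of the empty set.
  have hK : ∀ K : Set X, IsCompact K → ∃ g : C₀(X, ℂ), g ∉ N ∧ ∀ x ∈ K, g x = 0 := by
    intro K hK
    refine hK.induction_on (p := fun K => ∃ g : C₀(X, ℂ), g ∉ N ∧ ∀ x ∈ K, g x = 0) ?_ ?_ ?_ ?_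
    · obtain ⟨g, hg⟩ := (Set.ne_univ_iff_exists_notMem N).1 hN'
      exact ⟨g, hg, fun x hx => hx.elim⟩
    · exact fun s t hst ⟨g, hg, h⟩ => ⟨g, hg, fun x hx => h x (hst hx)⟩
    · rintro s t ⟨g, hg, h⟩ ⟨g', hg', h'⟩
      refine ⟨g * g', fun hN => (hprime _ _ hN).elim hg hg', fun x hx => ?_⟩
      rcases hx with hx | hx
      · simp [h x hx]
      · simp [h' x hx]
    · intro x _
      obtain ⟨g, hg, h⟩ := hloc x
      exact ⟨_, mem_nhdsWithin_of_mem_nhds h, g, hg, fun y hy => hy⟩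
  -- The truncation of `f` vanishes off the compact set `{ε ≤ |f|}`, where `g` vanishes. Their
  -- product is `0 ∈ N`, so the truncation lies in `N`, and hence so does `f`.
  refine hN' (Set.eq_univ_of_forall fun f => mem_of_truncate_mem hN f fun ε hε => ?_)
  obtain ⟨g, hg, h⟩ := hK _ (f.isCompact_le_norm hε)
  refine (hprime g (f.truncate hε) ?_).resolve_left hg
  convert h0
  ext x
  by_cases hx : ε ≤ ‖f x‖
  · simp [h x hx]
  · simp [f.truncate_apply_eq_zero hε (not_le.1 hx).le]

/-- Urysohn functions in `C₀(X)`. -/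
lemma exists_apply_eq_one [T2Space X] [LocallyCompactSpace X] {u : X} {U : Set X}
    (hU : IsOpen U) (hu : u ∈ U) : ∃ f : C₀(X, ℂ), f u = 1 ∧ ∀ x ∉ U, f x = 0 := by
  obtain ⟨f, h1, h0, hc, -⟩ := exists_continuous_one_zero_of_isCompact (isCompact_singleton (x := u))
    hU.isClosed_compl (by simpa using hu)
  have hc' : HasCompactSupport fun x => (f x : ℂ) := hc.comp_left Complex.ofReal_zero
  refine ⟨⟨⟨fun x => (f x : ℂ), by fun_prop⟩, hc'.is_zero_at_infty⟩, ?_, fun x hx => ?_⟩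
  · simpa using h1 rfl
  · simpa using h0 hx

end ZeroAtInftyContinuousMap

/-! ### Fibres of a `C₀(X)`-algebra and continuity of sections. -/

namespace C0Algebra

variable {X : Type*} [TopologicalSpace X] {A : Type*} [NonUnitalCStarAlgebra A] (S : C0Algebra X A)

lemma smul_mem_fiberIdeal {u : X} {f : C₀(X, ℂ)} (hf : f u = 0) (a : A) :
    S.smul f a ∈ S.fiberIdeal u :=
  Submodule.le_topologicalClosure _ (Submodule.subset_span ⟨f, a, hf, rfl⟩)

/-- A closed subspace containing the generators of `I_u` contains `I_u`. -/
lemma fiberIdeal_le {u : X} {V : Submodule ℂ A} (hV : IsClosed (V : Set A))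
    (h : ∀ (f : C₀(X, ℂ)) (a : A), f u = 0 → S.smul f a ∈ V) : S.fiberIdeal u ≤ V := by
  refine Submodule.topologicalClosure_minimal _ (Submodule.span_le.2 ?_) hV
  rintro _ ⟨f, a, hf, rfl⟩
  exact h f a hf

/-- Nondegeneracy: a closed subspace containing all products `f · a` is everything. -/
lemma mem_of_forall_smul_mem {V : Submodule ℂ A} (hV : IsClosed (V : Set A))
    (h : ∀ (f : C₀(X, ℂ)) (a : A), S.smul f a ∈ V) (a : A) : a ∈ V := by
  have : (⊤ : Submodule ℂ A) ≤ V := by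
    rw [← S.nondegenerate]
    refine Submodule.topologicalClosure_minimal _ (Submodule.span_le.2 ?_) hV
    rintro _ ⟨f, a, rfl⟩
    exact h f a
  exact this trivial

lemma smul_smul (f g : C₀(X, ℂ)) (a : A) : S.smul f (S.smul g a) = S.smul (f * g) a := by
  simp [smul, map_mul]

lemma sub_smul (f g : C₀(X, ℂ)) (a : A) : S.smul (f - g) a = S.smul f a - S.smul g a := by
  simp [smul, map_sub]

lemma const_smul (c : ℂ) (f : C₀(X, ℂ)) (a : A) : S.smul (c • f) a = c • S.smul f a := by
  simp [smul, map_smul]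

/-- On the fibre `A(u)`, a function `f` acts as the scalar `f u`. -/
lemma smul_sub_mem_fiberIdeal (u : X) (f : C₀(X, ℂ)) (a : A) :
    S.smul f a - f u • a ∈ S.fiberIdeal u := by
  let T : A →L[ℂ] A := (S.Φ f).fst - f u • ContinuousLinearMap.id ℂ A
  -- By nondegeneracy it suffices to treat `a = g · b`, where the difference is `(f g - f(u) g) ·
  -- b`, and this function vanishes at `u`.
  have key := S.mem_of_forall_smul_mem (V := (S.fiberIdeal u).comap (T : A →ₗ[ℂ] A))
    ((S.isClosed_fiberIdeal u).preimage T.continuous) (fun g b => ?_) a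
  · exact key
  · change S.smul f (S.smul g b) - f u • S.smul g b ∈ S.fiberIdeal u
    rw [smul_smul, ← const_smul, ← sub_smul]
    exact S.smul_mem_fiberIdeal (by simp) b

lemma continuous_smul_left (a : A) : Continuous fun f : C₀(X, ℂ) => S.smul f a := by
  have h1 : Continuous S.Φ := AddMonoidHomClass.continuous_of_bound S.Φ 1 fun f => by
    simpa using NonUnitalStarAlgHom.norm_apply_le S.Φ f
  have h2 : Continuous fun m : 𝓜(ℂ, A) => m.fst a := by
    refine (LinearMap.mkContinuous (⟨⟨fun m => m.fst a, fun _ _ => rfl⟩, fun _ _ => rfl⟩ :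
      𝓜(ℂ, A) →ₗ[ℂ] A) ‖a‖ fun m => ?_).continuous
    rw [mul_comm, ← DoubleCentralizer.norm_fst]
    exact m.fst.le_opNorm a
  exact h2.comp h1

namespace Fiber

variable {S}

lemma norm_mk_le (u : X) (a : A) : ‖mk S u a‖ ≤ ‖a‖ :=
  Submodule.Quotient.norm_mk_le (S.fiberIdeal u) a

lemma exists_norm_lt {u : X} {x : S.Fiber u} {c : ℝ} (hx : ‖x‖ < c) :
    ∃ a, mk S u a = x ∧ ‖a‖ < c := by
  obtain ⟨a, ha, h⟩ := Submodule.Quotient.norm_mk_lt (S := S.fiberIdeal u) x (sub_pos.2 hx)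
  exact ⟨a, ha, h.trans_eq (add_sub_cancel _ _)⟩

lemma mk_eq_zero {u : X} {a : A} : mk S u a = 0 ↔ a ∈ S.fiberIdeal u :=
  Submodule.Quotient.mk_eq_zero _

lemma mk_sub (u : X) (a b : A) : mk S u (a - b) = mk S u a - mk S u b := rfl

lemma norm_smul_le (u : X) (f : C₀(X, ℂ)) (a : A) : ‖mk S u (S.smul f a)‖ ≤ ‖f u‖ * ‖a‖ := by
  rw [mk_eq_mk S |>.2 (S.smul_sub_mem_fiberIdeal u f a), ← norm_smul]
  exact norm_mk_le u _

variable (S)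

/-- The functions `u ↦ ‖a(u)‖` for `a ∈ I_v` vanish at `v` continuously. -/
lemma tendsto_norm_mk {v : X} {a : A} (ha : a ∈ S.fiberIdeal v) :
    Tendsto (fun u => ‖mk S u a‖) (𝓝 v) (𝓝 0) := by
  -- The elements with this limit form a closed subspace, so only the generators `f · b` of `I_v`
  -- need checking. There `norm_smul_le` gives the bound `|f(u)| ‖b‖`.
  let V : Submodule ℂ A :=
    { carrier := {a | Tendsto (fun u => ‖mk S u a‖) (𝓝 v) (𝓝 0)}
      add_mem' := fun {a b} ha hb => squeeze_zero (fun _ => norm_nonneg _)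
        (fun u => (norm_add_le (mk S u a) (mk S u b))) (by simpa using ha.add hb)
      zero_mem' := by simp [mk_zero]
      smul_mem' := fun c a ha => squeeze_zero (g := fun u => ‖c‖ * ‖mk S u a‖)
        (fun _ => norm_nonneg _)
        (fun u => _root_.norm_smul_le c (Submodule.Quotient.mk a : A ⧸ S.fiberIdeal u))
        (by simpa using Tendsto.const_mul ‖c‖ ha) }
  have hV : IsClosed (V : Set A) := by
    refine isClosed_of_closure_subset fun a ha => ?_
    change Tendsto _ _ _
    rw [Metric.tendsto_nhds]
    intro ε hε
    obtain ⟨b, hb, hab⟩ := Metric.mem_closure_iff.1 ha (ε / 2) (half_pos hε)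
    filter_upwards [Metric.tendsto_nhds.1 (show Tendsto _ _ _ from hb) (ε / 2) (half_pos hε)]
      with u hu
    simp only [dist_zero_right, norm_norm] at hu ⊢
    have h1 : ‖mk S u (a - b)‖ < ε / 2 := (norm_mk_le u _).trans_lt (by rwa [← dist_eq_norm])
    have h2 := norm_add_le (mk S u (a - b)) (mk S u b)
    rw [← mk_add, sub_add_cancel] at h2
    linarith
  refine S.fiberIdeal_le hV (fun f b hf => ?_) ha
  refine squeeze_zero (fun _ => norm_nonneg _) (fun u => norm_smul_le u f b) ?_
  simpa [hf] using ((map_continuous f).norm.tendsto v).mul_const ‖b‖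

/-- The norm `u ↦ ‖a(u)‖` is upper semicontinuous. -/
lemma isOpen_norm_mk_lt (a : A) (ε : ℝ) : IsOpen {u | ‖mk S u a‖ < ε} := by
  rw [isOpen_iff_mem_nhds]
  intro v hv
  -- `b` agrees with `a` at `v` and has norm below `ε`. Since `a - b ∈ I_v`, the norm of `(a -
  -- b)(u)` stays below `ε - ‖b‖` near `v`.
  obtain ⟨b, hb, hbε⟩ := exists_norm_lt (show ‖mk S v a‖ < ε from hv)
  have h := tendsto_norm_mk S ((mk_eq_mk S).1 hb.symm)
  filter_upwards [h.eventually_lt_const (sub_pos.2 hbε)] with u hu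
  have h2 := norm_add_le (mk S u (a - b)) (mk S u b)
  rw [← mk_add, sub_add_cancel] at h2
  have := norm_mk_le (S := S) u b
  change ‖mk S u a‖ < ε
  linarith

end Fiber

/-- The sections `u ↦ a(u)` of the bundle are continuous. -/
lemma continuous_section (a : A) : Continuous fun u => (⟨u, Fiber.mk S u a⟩ : S.Bundle) := by
  refine continuous_generateFrom_iff.2 ?_
  rintro _ ⟨b, U, ε, hU, -, rfl⟩
  exact hU.inter (Fiber.isOpen_norm_mk_lt S (b - a) ε)

/-- The basic neighbourhoods of the bundle. -/
lemma isOpen_norm_mk_sub_lt (a : A) {ε : ℝ} (hε : 0 < ε) :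
    IsOpen {b : S.Bundle | ‖Fiber.mk S b.base a - b.val‖ < ε} :=
  TopologicalSpace.isOpen_generateFrom_of_mem
    ⟨a, Set.univ, ε, isOpen_univ, hε, by simp⟩

end C0Algebra

/-! ### Kernels of irreducible representations. -/

namespace IrrRep

variable {A : Type w} [NonUnitalCStarAlgebra A]

lemma mem_ker {π : IrrRep A} {a : A} : a ∈ π.ker ↔ π.toHom a = 0 := Iff.rfl

lemma norm_toHom_le (π : IrrRep A) (a : A) : ‖π.toHom a‖ ≤ ‖a‖ :=
  NonUnitalStarAlgHom.norm_apply_le π.toHom a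

lemma continuous_toHom (π : IrrRep A) : Continuous π.toHom :=
  AddMonoidHomClass.continuous_of_bound π.toHom 1 fun a => by simpa using π.norm_toHom_le a

/-- The kernel of an irreducible representation as a closed subspace. -/
def kerSubmodule (π : IrrRep A) : Submodule ℂ A :=
  LinearMap.ker (π.toHom : A →ₗ[ℂ] (π.H →L[ℂ] π.H))

lemma isClosed_ker (π : IrrRep A) : IsClosed π.ker :=
  isClosed_eq π.continuous_toHom continuous_const

/-- If `R` is stable under left multiplication and not contained in the kernel of `π`, an operator
vanishing on the ranges of all `π(b)`, `b ∈ R`, is zero. -/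
lemma eq_zero_of_forall_comp_eq_zero (π : IrrRep A) {R : Set A} (hR : ∀ a, ∀ b ∈ R, a * b ∈ R)
    (hR' : ¬ R ⊆ π.ker) (T : π.H →L[ℂ] π.H) (hT : ∀ b ∈ R, T ∘L π.toHom b = 0) : T = 0 := by
  -- The closed span of `π(R)H` is invariant and nonzero, so irreducibility makes it all of `H`; `T`
  -- vanishes on it.
  let K : Submodule ℂ π.H :=
    (Submodule.span ℂ {y | ∃ b ∈ R, ∃ x, y = π.toHom b x}).topologicalClosure
  have hinv : ∀ a, ∀ x ∈ K, π.toHom a x ∈ K := by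
    intro a x hx
    refine map_mem_closure (π.toHom a).continuous hx fun y hy => ?_
    have : Submodule.span ℂ {y | ∃ b ∈ R, ∃ x, y = π.toHom b x} ≤
        (Submodule.span ℂ {y | ∃ b ∈ R, ∃ x, y = π.toHom b x}).comap
          (π.toHom a : π.H →ₗ[ℂ] π.H) := by
      refine Submodule.span_le.2 ?_
      rintro _ ⟨b, hb, x, rfl⟩
      refine Submodule.subset_span ⟨a * b, hR a b hb, x, ?_⟩
      simp
    exact this hy
  have hsub : ∀ b ∈ R, ∀ x, π.toHom b x ∈ K := fun b hb x =>
    Submodule.le_topologicalClosure _ (Submodule.subset_span ⟨b, hb, x, rfl⟩)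
  rcases π.irreducible K (Submodule.isClosed_topologicalClosure _) hinv with h | h
  · refine absurd (fun b hb => ?_) hR'
    rw [mem_ker]
    ext x
    have := hsub b hb x
    rw [h, Submodule.mem_bot] at this
    simpa using this
  · have hle : K ≤ LinearMap.ker (T : π.H →ₗ[ℂ] π.H) := by
      refine Submodule.topologicalClosure_minimal _ (Submodule.span_le.2 ?_) T.isClosed_ker
      rintro _ ⟨b, hb, x, rfl⟩
      exact congrArg (fun Q : π.H →L[ℂ] π.H => Q x) (hT b hb)
    rw [h] at hle
    ext x
    exact hle (Submodule.mem_top (x := x))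

end IrrRep

/-! ### The hull-kernel topology and lower semicontinuity of the norm. -/

namespace IrrSpectrum

variable {A : Type w} [NonUnitalCStarAlgebra A]

lemma mk_out (σ : IrrSpectrum A) : mk (Quotient.out σ) = σ := Quotient.out_eq σ

lemma ker_mk (π : IrrRep A) : (mk π).ker = π.ker := rfl

lemma exists_mk (σ : IrrSpectrum A) : ∃ π, mk π = σ := ⟨_, σ.mk_out⟩

/-- The set of points whose kernel does not contain the intersection of the kernels of the points
of a given set is open. -/
lemma isOpen_not_iInter_ker_subset (F : Set (IrrSpectrum A)) :
    IsOpen {σ : IrrSpectrum A | ∃ a, (∀ τ ∈ F, a ∈ τ.ker) ∧ a ∉ σ.ker} := by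
  let J : TwoSidedIdeal A := TwoSidedIdeal.mk' {a | ∀ π : IrrRep A, mk π ∈ F → π.toHom a = 0}
    (fun π _ => map_zero _) (fun ha hb π hπ => by rw [map_add, ha π hπ, hb π hπ, add_zero])
    (fun ha π hπ => by rw [map_neg, ha π hπ, neg_zero])
    (fun ha π hπ => by rw [map_mul, ha π hπ, mul_zero])
    (fun ha π hπ => by rw [map_mul, ha π hπ, zero_mul])
  have hJ : (J : Set A) = {a | ∀ π : IrrRep A, mk π ∈ F → π.toHom a = 0} :=
    TwoSidedIdeal.coe_mk' ..
  refine TopologicalSpace.isOpen_generateFrom_of_mem ⟨J, ?_, ?_⟩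
  · rw [hJ, show {a | ∀ π : IrrRep A, mk π ∈ F → π.toHom a = 0} =
      ⋂ (π : IrrRep A) (_ : mk π ∈ F), π.ker by ext; simp [IrrRep.mem_ker]]
    exact isClosed_iInter fun π => isClosed_iInter fun _ => π.isClosed_ker
  · ext σ
    rw [hJ]
    simp only [Set.mem_ofPred_eq, Set.not_subset]
    refine exists_congr fun a => and_congr_left fun _ => ⟨fun h π hπ => h _ hπ, fun h τ hτ => ?_⟩
    obtain ⟨π, rfl⟩ := τ.exists_mk
    exact h π hτ

/-- The intersection of the kernels containing `a` serves as the ideal, which avoids describing the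
closed ideal generated by `a`. -/
lemma isOpen_notMem_ker (a : A) : IsOpen {σ : IrrSpectrum A | a ∉ σ.ker} := by
  convert isOpen_not_iInter_ker_subset {σ : IrrSpectrum A | a ∈ σ.ker} using 1
  ext σ
  refine ⟨fun h => ⟨a, fun τ hτ => hτ, h⟩, ?_⟩
  rintro ⟨b, hb, hbσ⟩ ha
  exact hbσ (hb σ ha)

/-- The functional calculus of `t ↦ t - max (-δ) (min t δ)`, which vanishes exactly on
`[-δ, δ]`. -/
def cutoff {B : Type*} [NonUnitalCStarAlgebra B] (δ : ℝ) (b : B) : B :=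
  cfcₙ (fun t : ℝ => t - max (-δ) (min t δ)) b

lemma map_cutoff {B : Type*} [NonUnitalCStarAlgebra B] (φ : A →⋆ₙₐ[ℂ] B) (hφ : Continuous φ)
    {δ : ℝ} (hδ : 0 ≤ δ) {a : A} (ha : IsSelfAdjoint a) : φ (cutoff δ a) = cutoff δ (φ a) :=
  NonUnitalStarAlgHomClass.map_cfcₙ (φ.restrictScalars ℝ) (fun t : ℝ => t - max (-δ) (min t δ)) a
    (by fun_prop) (by simp [hδ]) hφ ha (ha.map φ)

/-- If the cutoff vanishes, `b` equals its clamping to `[-δ, δ]`, which has norm at most `δ`.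
Conversely, `‖b‖ ≤ δ` puts the quasispectrum inside that interval. -/
lemma cutoff_eq_zero_iff {B : Type*} [NonUnitalCStarAlgebra B] {δ : ℝ} (hδ : 0 ≤ δ) {b : B}
    (hb : IsSelfAdjoint b) : cutoff δ b = 0 ↔ ‖b‖ ≤ δ := by
  have h0 : max (-δ) (min 0 δ) = 0 := by simp [hδ]
  constructor
  · intro h
    have h1 : cutoff δ b = b - cfcₙ (fun t : ℝ => max (-δ) (min t δ)) b := by
      rw [cutoff, cfcₙ_sub (fun t : ℝ => t) (fun t => max (-δ) (min t δ)) b (by fun_prop) (by simp)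
        (by fun_prop) h0, cfcₙ_id' ℝ b]
    rw [h, eq_comm, sub_eq_zero] at h1
    rw [h1]
    refine norm_cfcₙ_le fun t _ => ?_
    rw [Real.norm_eq_abs, abs_le]
    exact ⟨le_max_left _ _, max_le (by linarith) (min_le_right _ _)⟩
  · intro h
    refine (cfcₙ_congr fun t ht => ?_).trans (cfcₙ_const_zero ℝ b)
    have := (NonUnitalIsometricContinuousFunctionalCalculus.norm_quasispectrum_le b ht hb).trans h
    rw [Real.norm_eq_abs, abs_le] at this
    simp [this.1, this.2]

/-- The norm `σ ↦ ‖σ(a)‖` is lower semicontinuous. -/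
lemma exists_isOpen_lt_norm (a : A) {δ : ℝ} (hδ : 0 ≤ δ) :
    ∃ O : Set (IrrSpectrum A), IsOpen O ∧ ∀ π : IrrRep A, mk π ∈ O ↔ δ < ‖π.toHom a‖ := by
  -- By the C⋆-identity, `‖π(a)‖ > δ` means `‖π(a⋆a)‖ > δ²`, that is, `π` does not kill the cutoff
  -- of `a⋆a` at `δ²`.
  refine ⟨_, isOpen_notMem_ker (cutoff (δ * δ) (star a * a)), fun π => ?_⟩
  change ¬ π.toHom (cutoff (δ * δ) (star a * a)) = 0 ↔ _
  rw [map_cutoff π.toHom π.continuous_toHom (mul_nonneg hδ hδ) (IsSelfAdjoint.star_mul_self a),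
    map_mul, map_star, cutoff_eq_zero_iff (mul_nonneg hδ hδ)
    (IsSelfAdjoint.star_mul_self (π.toHom a)), CStarRing.norm_star_mul_self, not_le,
    mul_self_lt_mul_self_iff hδ (norm_nonneg _)]

end IrrSpectrum

/-! ### The anchor map of the spectrum. -/

namespace C0Algebra

variable {X : Type*} [TopologicalSpace X] {A : Type w} [NonUnitalCStarAlgebra A]
  (S : C0Algebra X A)

/-- An irreducible representation factors through some fibre. -/
lemma exists_fiberIdeal_subset_ker (π : IrrRep A) :
    ∃ u, (S.fiberIdeal u : Set A) ⊆ π.ker := by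
  let N : Set C₀(X, ℂ) := {f | ∀ a, π.toHom (S.smul f a) = 0}
  have hclosed : IsClosed N := by
    have : N = ⋂ a, {f | π.toHom (S.smul f a) = 0} := by ext; simp [N]
    rw [this]
    exact isClosed_iInter fun a => isClosed_eq
      (π.continuous_toHom.comp (S.continuous_smul_left a)) continuous_const
  have hproper : N ≠ Set.univ := by
    intro hN
    obtain ⟨a, ha⟩ := π.nonzero
    refine ha (S.mem_of_forall_smul_mem (V := π.kerSubmodule) π.isClosed_ker (fun f a => ?_) a)
    exact (hN.symm ▸ Set.mem_univ f : f ∈ N) a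
  have hzero : 0 ∈ N := fun a => by simp [smul]
  have hprime : ∀ f g : C₀(X, ℂ), f * g ∈ N → f ∈ N ∨ g ∈ N := by
    intro f g hfg
    by_contra! h
    obtain ⟨hf, hg⟩ := h
    -- Centrality gives `π(f · a) π(g · b) = π(fg · ab) = 0`. If `g ∉ N`, the elements `g · b` are
    -- not all killed, so `π(f · a) = 0`.
    refine hf fun a => π.eq_zero_of_forall_comp_eq_zero (R := Set.range (S.smul g)) ?_ ?_ _ ?_
    · rintro b _ ⟨c, rfl⟩
      exact ⟨b * c, (S.mul_smul' g b c).symm⟩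
    · exact fun h => hg fun a => h ⟨a, rfl⟩
    · rintro _ ⟨b, rfl⟩
      change π.toHom (S.smul f a) * π.toHom (S.smul g b) = 0
      rw [← map_mul, S.smul_mul, S.mul_smul', S.smul_smul]
      exact hfg _
  obtain ⟨u, hu⟩ :=
    ZeroAtInftyContinuousMap.exists_forall_apply_eq_zero_mem hclosed hproper hzero hprime
  exact ⟨u, S.fiberIdeal_le (V := π.kerSubmodule) π.isClosed_ker fun f a hf => hu f hf a⟩

/-- If `π` factors through `A(u)`, then `π(f · a) = f(u) π(a)`. -/
lemma toHom_smul {π : IrrRep A} {u : X} (hu : (S.fiberIdeal u : Set A) ⊆ π.ker) (f : C₀(X, ℂ))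
    (a : A) : π.toHom (S.smul f a) = f u • π.toHom a := by
  have h := hu (S.smul_sub_mem_fiberIdeal u f a)
  rwa [IrrRep.mem_ker, map_sub, map_smul, sub_eq_zero] at h

/-- Since `f` acts through `π` as the scalar `f(u)`, a Urysohn function with `f(u) = 1` works. This
separates anchors and makes the anchor map continuous. -/
lemma exists_smul_notMem_ker [T2Space X] [LocallyCompactSpace X] {π : IrrRep A} {u : X}
    (hu : (S.fiberIdeal u : Set A) ⊆ π.ker) {U : Set X} (hU : IsOpen U) (huU : u ∈ U) :
    ∃ (f : C₀(X, ℂ)) (a : A), (∀ x ∉ U, f x = 0) ∧ S.smul f a ∉ π.ker := by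
  obtain ⟨f, h1, h0⟩ := ZeroAtInftyContinuousMap.exists_apply_eq_one hU huU
  obtain ⟨a, ha⟩ := π.nonzero
  exact ⟨f, a, h0, by rwa [IrrRep.mem_ker, S.toHom_smul hu, h1, one_smul]⟩

lemma eq_of_fiberIdeal_subset_ker [T2Space X] [LocallyCompactSpace X] {π : IrrRep A} {u v : X}
    (hu : (S.fiberIdeal u : Set A) ⊆ π.ker) (hv : (S.fiberIdeal v : Set A) ⊆ π.ker) : u = v := by
  by_contra huv
  obtain ⟨f, a, hf, hfa⟩ := S.exists_smul_notMem_ker hu isOpen_compl_singleton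
    (Set.mem_compl_singleton_iff.2 huv)
  exact hfa (hv (S.smul_mem_fiberIdeal (hf v (by simp)) a))

lemma existsUnique_fiberIdeal_subset_ker [T2Space X] [LocallyCompactSpace X] (σ : IrrSpectrum A) :
    ∃! u, (S.fiberIdeal u : Set A) ⊆ σ.ker := by
  obtain ⟨π, rfl⟩ := σ.exists_mk
  obtain ⟨u, hu⟩ := S.exists_fiberIdeal_subset_ker π
  exact ⟨u, hu, fun v hv => S.eq_of_fiberIdeal_subset_ker hv hu⟩

lemma factor_mk {π : IrrRep A} {u : X} (hπ : (S.fiberIdeal u : Set A) ⊆ π.ker) (a : A) :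
    (factor π hπ).toHom (Fiber.mk S u a) = π.toHom a := rfl

/-- If `π` factors through `A(u)`, then `‖π(a)‖ ≤ ‖a(u)‖`. -/
lemma norm_toHom_le_norm_mk {π : IrrRep A} {u : X} (hπ : (S.fiberIdeal u : Set A) ⊆ π.ker)
    (a : A) : ‖π.toHom a‖ ≤ ‖Fiber.mk S u a‖ := by
  refine le_of_forall_gt fun c hc => ?_
  obtain ⟨b, hb, hbc⟩ := Fiber.exists_norm_lt hc
  have h := hπ ((Fiber.mk_eq_mk S).1 hb)
  rw [IrrRep.mem_ker, map_sub, sub_eq_zero] at h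
  rw [← h]
  exact (π.norm_toHom_le b).trans_lt hbc

variable [T2Space X] [LocallyCompactSpace X]

/-- The anchor map of the spectrum: the point of `X` over which a representation lives. -/
def anchor (σ : IrrSpectrum A) : X := (S.existsUnique_fiberIdeal_subset_ker σ).choose

lemma anchor_eq_iff (σ : IrrSpectrum A) (u : X) :
    S.anchor σ = u ↔ (S.fiberIdeal u : Set A) ⊆ σ.ker := by
  have h := (S.existsUnique_fiberIdeal_subset_ker σ).choose_spec
  exact ⟨fun hu => hu ▸ h.1, fun hu => (h.2 u hu).symm⟩

lemma anchor_mk_eq_iff (π : IrrRep A) (u : X) :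
    S.anchor (IrrSpectrum.mk π) = u ↔ (S.fiberIdeal u : Set A) ⊆ π.ker :=
  S.anchor_eq_iff _ u

lemma continuous_anchor : Continuous S.anchor := by
  refine continuous_def.2 fun U hU => ?_
  -- An element `f · a` with `f` vanishing off `U` is killed by every point anchored outside `U`,
  -- but can be chosen to survive at a given point anchored in `U`.
  convert IrrSpectrum.isOpen_not_iInter_ker_subset {σ | S.anchor σ ∉ U} using 1
  ext σ
  constructor
  · intro hσ
    obtain ⟨π, rfl⟩ := σ.exists_mk
    obtain ⟨f, a, hf, hfa⟩ := S.exists_smul_notMem_ker ((S.anchor_eq_iff _ _).1 rfl) hU hσ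
    exact ⟨_, fun τ hτ => (S.anchor_eq_iff τ _).1 rfl (S.smul_mem_fiberIdeal (hf _ hτ) a), hfa⟩
  · rintro ⟨a, ha, haσ⟩
    by_contra h
    exact haσ (ha σ h)

end C0Algebra

/-! ### The unit space is Hausdorff and locally compact. -/

namespace TopologicalGroupoid

variable {X : Type*} [Groupoid X] [TopologicalSpace X] [TopologicalSpace (Quiver.Total X)]
  [TopologicalGroupoid X]

variable (X) in
lemma t2Space_units [T2Space (Quiver.Total X)] : T2Space X :=
  .of_injective_continuous (f := fun u : X => (⟨u, u, 𝟙 u⟩ : Quiver.Total X))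
    (fun _ _ h => congrArg Quiver.Total.left h) continuous_unit

variable (X) in
-- The unit map is a section of the source map, and its range is the equalizer of `γ ↦ 1_{s(γ)}` and
-- the identity, closed because the arrow space is Hausdorff.
lemma isClosedEmbedding_unit [T2Space (Quiver.Total X)] :
    IsClosedEmbedding fun u : X => (⟨u, u, 𝟙 u⟩ : Quiver.Total X) := by
  have hs : Continuous fun γ : Quiver.Total X => γ.left := continuous_source
  have hu : Continuous fun u : X => (⟨u, u, 𝟙 u⟩ : Quiver.Total X) := continuous_unit
  refine IsClosedEmbedding.mk (.of_leftInverse (fun _ => rfl) hs hu) ?_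
  convert isClosed_eq (hu.comp hs) continuous_id
  ext γ
  exact ⟨fun ⟨u, h⟩ => h ▸ rfl, fun h => ⟨γ.left, h⟩⟩

variable (X) in
lemma locallyCompactSpace_units [T2Space (Quiver.Total X)] [LocallyCompactSpace (Quiver.Total X)] :
    LocallyCompactSpace X :=
  (isClosedEmbedding_unit X).locallyCompactSpace

end TopologicalGroupoid

/-! ### The action on the spectrum and its continuity. -/

namespace GroupoidDynamicalSystem

variable {X : Type*} [Groupoid X] [TopologicalSpace X] [TopologicalSpace (Quiver.Total X)]
  {A : Type w} [NonUnitalCStarAlgebra A] {S : C0Algebra X A} (D : GroupoidDynamicalSystem S)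

/-- Multiplicativity makes `α` of a unit idempotent, and an injective idempotent map is the
identity. -/
lemma α_id (u : X) (x : S.Fiber u) : D.α (𝟙 u) x = x := by
  refine EquivLike.injective (D.α (𝟙 u)) ?_
  rw [← D.α_mul, Category.comp_id]

lemma α_symm_id (u : X) (x : S.Fiber u) : (D.α (𝟙 u)).symm x = x := by
  conv_lhs => rw [← D.α_id u x]
  exact StarAlgEquiv.symm_apply_apply _ _

/-- Allows the continuity of `α`, combined with that of inversion in the groupoid, to be used for
`α_γ⁻¹`. -/
lemma α_inv {u v : X} (γ : u ⟶ v) (x : S.Fiber v) :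
    D.α (Groupoid.inv γ) x = (D.α γ).symm x := by
  refine EquivLike.injective (D.α γ) ?_
  rw [← D.α_mul, Groupoid.inv_comp, α_id, StarAlgEquiv.apply_symm_apply]

lemma translate_toHom {u v : X} (γ : u ⟶ v) {π : IrrRep A}
    (hπ : (S.fiberIdeal u : Set A) ⊆ π.ker) (a : A) :
    (D.translate γ π hπ).toHom a =
      (C0Algebra.factor π hπ).toHom ((D.α γ).symm (C0Algebra.Fiber.mk S v a)) := rfl

lemma fiberIdeal_subset_ker_translate {u v : X} (γ : u ⟶ v) {π : IrrRep A}
    (hπ : (S.fiberIdeal u : Set A) ⊆ π.ker) :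
    (S.fiberIdeal v : Set A) ⊆ (D.translate γ π hπ).ker := by
  intro a ha
  rw [IrrRep.mem_ker, translate_toHom, C0Algebra.Fiber.mk_eq_zero.2 ha, map_zero, map_zero]
  rfl

/-- A unitary intertwining `π` and `ρ` also intertwines the translates, whose operators are values
of `π` and `ρ` at a common lift `b`. -/
lemma mk_translate_congr {u v : X} (γ : u ⟶ v) {π ρ : IrrRep A}
    (h : IrrSpectrum.mk π = IrrSpectrum.mk ρ) (hπ : (S.fiberIdeal u : Set A) ⊆ π.ker)
    (hρ : (S.fiberIdeal u : Set A) ⊆ ρ.ker) :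
    IrrSpectrum.mk (D.translate γ π hπ) = IrrSpectrum.mk (D.translate γ ρ hρ) := by
  obtain ⟨U, hU⟩ := Quotient.exact h
  refine Quotient.sound ⟨U, fun a x => ?_⟩
  rw [translate_toHom, translate_toHom]
  obtain ⟨b, hb⟩ := C0Algebra.Fiber.mk_surjective S ((D.α γ).symm (C0Algebra.Fiber.mk S v a))
  rw [← hb]
  exact hU b x

lemma mk_translate_id {u : X} {π : IrrRep A} (hπ : (S.fiberIdeal u : Set A) ⊆ π.ker) :
    IrrSpectrum.mk (D.translate (𝟙 u) π hπ) = IrrSpectrum.mk π := by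
  refine Quotient.sound ⟨LinearIsometryEquiv.refl ℂ π.H, fun a x => ?_⟩
  rw [translate_toHom, α_symm_id]
  rfl

lemma mk_translate_comp {u v w : X} (η : u ⟶ v) (γ : v ⟶ w) {π : IrrRep A}
    (hπ : (S.fiberIdeal u : Set A) ⊆ π.ker) :
    IrrSpectrum.mk (D.translate (η ≫ γ) π hπ) = IrrSpectrum.mk
      (D.translate γ (D.translate η π hπ) (D.fiberIdeal_subset_ker_translate η hπ)) := by
  refine Quotient.sound ⟨LinearIsometryEquiv.refl ℂ π.H, fun a x => ?_⟩
  have h : (D.translate (η ≫ γ) π hπ).toHom a = (D.translate γ (D.translate η π hπ)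
      (D.fiberIdeal_subset_ker_translate η hπ)).toHom a := by
    rw [translate_toHom, translate_toHom]
    obtain ⟨b, hb⟩ := C0Algebra.Fiber.mk_surjective S ((D.α γ).symm (C0Algebra.Fiber.mk S w a))
    rw [← hb, C0Algebra.factor_mk, translate_toHom, hb]
    congr 1
    refine EquivLike.injective (D.α (η ≫ γ)) ?_
    rw [StarAlgEquiv.apply_symm_apply, D.α_mul, StarAlgEquiv.apply_symm_apply,
      StarAlgEquiv.apply_symm_apply]
  exact congrArg (fun T : π.H →L[ℂ] π.H => T x) h

/-- The section `γ ↦ α_γ⁻¹(a(r(γ)))` of the pulled-back bundle is continuous. -/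
lemma continuous_α_symm_section [TopologicalGroupoid X] (a : A) :
    Continuous fun γ : Quiver.Total X =>
      (⟨γ.left, (D.α γ.hom).symm (C0Algebra.Fiber.mk S γ.right a)⟩ : S.Bundle) := by
  have h : Continuous fun γ : Quiver.Total X =>
      (⟨((⟨γ.right, γ.left, Groupoid.inv γ.hom⟩ : Quiver.Total X),
        (⟨γ.right, C0Algebra.Fiber.mk S γ.right a⟩ : S.Bundle)), rfl⟩ :
        {p : Quiver.Total X × S.Bundle // p.2.base = p.1.left}) :=
    (TopologicalGroupoid.continuous_inv.prodMk
      ((S.continuous_section a).comp TopologicalGroupoid.continuous_range)).subtype_mk _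
  refine (D.continuous_α.comp h).congr fun γ => ?_
  exact congrArg (C0Algebra.Bundle.mk γ.left) (D.α_inv γ.hom _)

/-- An element that is not killed by the translate of `π` by `γ` is not killed by nearby
translates of nearby representations. -/
lemma exists_isOpen_translate_notMem_ker [TopologicalGroupoid X] {γ₀ : Quiver.Total X}
    {π₀ : IrrRep A} (h₀ : (S.fiberIdeal γ₀.left : Set A) ⊆ π₀.ker) {a : A}
    (ha : a ∉ (D.translate γ₀.hom π₀ h₀).ker) :
    ∃ (V : Set (Quiver.Total X)) (O : Set (IrrSpectrum A)), IsOpen V ∧ IsOpen O ∧ γ₀ ∈ V ∧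
      IrrSpectrum.mk π₀ ∈ O ∧ ∀ γ ∈ V, ∀ (π : IrrRep A) (h : (S.fiberIdeal γ.left : Set A) ⊆ π.ker),
        IrrSpectrum.mk π ∈ O → a ∉ (D.translate γ.hom π h).ker := by
  obtain ⟨b, hb⟩ := C0Algebra.Fiber.mk_surjective S
    ((D.α γ₀.hom).symm (C0Algebra.Fiber.mk S γ₀.right a))
  have hb0 : 0 < ‖π₀.toHom b‖ := by
    rw [norm_pos_iff]
    intro h
    apply ha
    rw [IrrRep.mem_ker, translate_toHom, ← hb]
    exact h
  have hδ := half_pos hb0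
  obtain ⟨O, hO, hOmem⟩ := IrrSpectrum.exists_isOpen_lt_norm b hδ.le
  refine ⟨_, O, (S.isOpen_norm_mk_sub_lt b hδ).preimage (D.continuous_α_symm_section a), hO, ?_,
    (hOmem π₀).2 (half_lt_self hb0), fun γ hγ π h hπ hmem => ?_⟩
  · change ‖C0Algebra.Fiber.mk S γ₀.left b - _‖ < _
    rw [hb, sub_self, norm_zero]
    exact hδ
  · obtain ⟨c, hc⟩ := C0Algebra.Fiber.mk_surjective S
      ((D.α γ.hom).symm (C0Algebra.Fiber.mk S γ.right a))
    rw [IrrRep.mem_ker, translate_toHom, ← hc] at hmem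
    replace hmem : π.toHom c = 0 := hmem
    replace hγ : ‖C0Algebra.Fiber.mk S γ.left b -
      (D.α γ.hom).symm (C0Algebra.Fiber.mk S γ.right a)‖ < ‖π₀.toHom b‖ / 2 := hγ
    rw [← hc, ← C0Algebra.Fiber.mk_sub] at hγ
    -- If the translate killed `a`, then `π(c) = 0` and `‖π(b)‖ = ‖π(b - c)‖ < δ`, against the
    -- choice of `O`.
    have h1 := (S.norm_toHom_le_norm_mk h (b - c)).trans_lt hγ
    rw [map_sub, hmem, sub_zero] at h1
    exact lt_asymm h1 ((hOmem π).1 hπ)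

variable [T2Space X] [LocallyCompactSpace X]

/-- The action `γ · π = π ∘ α_γ⁻¹` of the arrows on the spectrum. -/
def spectrumAct {u v : X} (γ : u ⟶ v) (σ : {σ : IrrSpectrum A // S.anchor σ = u}) :
    {σ : IrrSpectrum A // S.anchor σ = v} :=
  have h : (S.fiberIdeal u : Set A) ⊆ (Quotient.out σ.1).ker := by
    rw [← IrrSpectrum.ker_mk, IrrSpectrum.mk_out]
    exact (S.anchor_eq_iff _ _).1 σ.2
  ⟨IrrSpectrum.mk (D.translate γ (Quotient.out σ.1) h),
    (S.anchor_eq_iff _ _).2 (D.fiberIdeal_subset_ker_translate γ h)⟩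

/-- Frees the action from the representative chosen by `Quotient.out`. -/
lemma spectrumAct_mk {u v : X} (γ : u ⟶ v) (π : IrrRep A)
    (hu : S.anchor (IrrSpectrum.mk π) = u) (hπ : (S.fiberIdeal u : Set A) ⊆ π.ker) :
    (D.spectrumAct γ ⟨IrrSpectrum.mk π, hu⟩ : IrrSpectrum A) =
      IrrSpectrum.mk (D.translate γ π hπ) :=
  D.mk_translate_congr γ (IrrSpectrum.mk_out _) _ hπ

/-- The continuous action of the groupoid on the spectrum induced by a dynamical system. -/
def spectrumAction [TopologicalGroupoid X] : ContinuousGroupoidAction X (IrrSpectrum A) where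
  anchor := S.anchor
  act := D.spectrumAct
  act_unit := by
    rintro u ⟨σ, hσ⟩
    obtain ⟨π, rfl⟩ := σ.exists_mk
    have hπ := (S.anchor_mk_eq_iff _ _).1 hσ
    exact Subtype.ext ((D.spectrumAct_mk _ π hσ hπ).trans (D.mk_translate_id hπ))
  act_mul := by
    rintro u v w η γ ⟨σ, hσ⟩
    obtain ⟨π, rfl⟩ := σ.exists_mk
    have hπ := (S.anchor_mk_eq_iff _ _).1 hσ
    have h1 : D.spectrumAct η ⟨IrrSpectrum.mk π, hσ⟩ = ⟨IrrSpectrum.mk (D.translate η π hπ),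
        (S.anchor_eq_iff _ _).2 (D.fiberIdeal_subset_ker_translate η hπ)⟩ :=
      Subtype.ext (D.spectrumAct_mk η π hσ hπ)
    refine Subtype.ext ?_
    rw [h1, D.spectrumAct_mk _ π hσ hπ, D.spectrumAct_mk γ _ _
      (D.fiberIdeal_subset_ker_translate η hπ), mk_translate_comp]
  continuous_anchor := S.continuous_anchor
  continuous_act := by
    refine continuous_generateFrom_iff.2 ?_
    rintro _ ⟨J, -, rfl⟩
    rw [isOpen_iff_mem_nhds]
    rintro ⟨⟨γ₀, σ₀⟩, h₀⟩ hmem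
    obtain ⟨π₀, rfl⟩ := σ₀.exists_mk
    have hπ₀ := (S.anchor_mk_eq_iff _ _).1 h₀
    -- One witness `a ∈ J` outside the kernel suffices: it remains outside the kernels at nearby
    -- points.
    obtain ⟨a, haJ, ha⟩ := Set.not_subset.1 (show ¬ (J : Set A) ⊆
      (D.spectrumAct γ₀.hom ⟨IrrSpectrum.mk π₀, h₀⟩ : IrrSpectrum A).ker from hmem)
    rw [D.spectrumAct_mk γ₀.hom π₀ h₀ hπ₀] at ha
    obtain ⟨V, O, hV, hO, hγ₀, hσ₀, hVO⟩ := D.exists_isOpen_translate_notMem_ker hπ₀ ha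
    filter_upwards [((hV.prod hO).preimage continuous_subtype_val).mem_nhds ⟨hγ₀, hσ₀⟩]
    rintro ⟨⟨γ, σ⟩, h⟩ ⟨hγ, hσ⟩
    obtain ⟨π, rfl⟩ := σ.exists_mk
    have hπ := (S.anchor_mk_eq_iff _ _).1 h
    change ¬ (J : Set A) ⊆ (D.spectrumAct γ.hom ⟨IrrSpectrum.mk π, h⟩ : IrrSpectrum A).ker
    rw [D.spectrumAct_mk γ.hom π h hπ]
    exact fun hJ => hVO γ hγ π hπ hσ (hJ haJ)

end GroupoidDynamicalSystem

/-- Continuous actions with the same anchor map and the same action of arrows are equal. -/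
lemma ContinuousGroupoidAction.eq_of_anchor_of_act {X : Type*} [Groupoid X] [TopologicalSpace X]
    [TopologicalSpace (Quiver.Total X)] {Y : Type*} [TopologicalSpace Y]
    {a b : ContinuousGroupoidAction X Y} (h : ∀ y, a.anchor y = b.anchor y)
    (h' : ∀ {u v : X} (γ : u ⟶ v) (y : Y) (ha : a.anchor y = u) (hb : b.anchor y = u),
      (a.act γ ⟨y, ha⟩ : Y) = b.act γ ⟨y, hb⟩) : a = b := by
  obtain ⟨f, p, _, _, _, _⟩ := a
  obtain ⟨g, q, _, _, _, _⟩ := b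
  -- The type of the arrow maps depends on the anchor, so the anchors are identified before the
  -- arrow maps.
  obtain rfl : f = g := funext h
  obtain rfl : @p = @q := by
    funext u v γ y
    exact Subtype.ext (h' γ y.1 y.2 y.2)
  rfl

end

theorem mainTheorem12 {X : Type*} [Groupoid X] [TopologicalSpace X]
    [TopologicalSpace (Quiver.Total X)] [TopologicalGroupoid X]
    [T2Space (Quiver.Total X)] [LocallyCompactSpace (Quiver.Total X)]
    {A : Type*} [NonUnitalCStarAlgebra A] (S : C0Algebra X A) (D : GroupoidDynamicalSystem S) :
    ∃! act : ContinuousGroupoidAction X (IrrSpectrum A),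
      (∀ (σ : IrrSpectrum A) (u : X), act.anchor σ = u ↔ (S.fiberIdeal u : Set A) ⊆ σ.ker) ∧
      (∀ {u v : X} (γ : u ⟶ v) (π : IrrRep A) (hu : act.anchor (IrrSpectrum.mk π) = u)
        (hπ : (S.fiberIdeal u : Set A) ⊆ π.ker),
        (act.act γ ⟨IrrSpectrum.mk π, hu⟩ : IrrSpectrum A) =
          IrrSpectrum.mk (D.translate γ π hπ)) := by
  have := TopologicalGroupoid.t2Space_units X
  have := TopologicalGroupoid.locallyCompactSpace_units X
  refine ⟨D.spectrumAction, ⟨S.anchor_eq_iff, D.spectrumAct_mk⟩, fun act ⟨h1, h2⟩ => ?_⟩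
  refine ContinuousGroupoidAction.eq_of_anchor_of_act
    (fun σ => (h1 σ _).2 ((S.anchor_eq_iff σ _).1 rfl)) fun {u v} γ σ ha hb => ?_
  obtain ⟨π, rfl⟩ := σ.exists_mk
  have hπ := (S.anchor_mk_eq_iff _ _).1 hb
  exact (h2 γ π ha hπ).trans (D.spectrumAct_mk γ π hb hπ).symm
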